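/- **Setting.** For a matroid $\mathcal M=(E,\mathcal I)$ with finite ground set, rank function $\mathrm{rk}$ and $\mathrm{rk}(E)>0$, the *fractional (base) packing number* is $$\Phi_{\mathcal M}:=\min_{\substack{A\subseteq E\\ \mathrm{rk}(E\setminus A)<\mathrm{rk}(E)}}\frac{|A|}{\mathrm{rk}(E)-\mathrm{rk}(E\setminus A)} .$$ A *dynamic matroid* is an initial matroid followed by a sequence of updates. Deleting $e\in E$ replaces $\mathcal M$ by its restriction to $E\setminus\{e\}$. Inserting $e\notin E$ replaces $\mathcal M$ by any matroid $(E\cup\{e\},\mathcal I\cup\mathcal I_e)$ in which every member of $\mathcal I_e$ contains $e$. A *deterministic dynamic algorithm* is told the initial ground set and then, at each update, which element is inserted or deleted; it may adaptively query the rank oracle of the current matroid (a query is a set $A$, the answer is $\mathrm{rk}(A)$), and it outputs a real number after the initialization and after each update. Only the rank-queries made while updates are handled are counted. **Theorem.** There is an absolute constant $C>0$ such that the following holds for every $\varepsilon\in(0,1/2)$, every integer $n\ge 1$, every real $\Phi_{\max}>0$ and every set from which the elements are taken. Consider all dynamic matroids that at any moment contain at most $n$ elements and satisfy $\Phi\le\Phi_{\max}$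 whenever $\mathrm{rk}(E)>0$. 1. There is a deterministic dynamic algorithm whose output $\tilde\Phi$ satisfies $(1-\varepsilon)\Phi\le\tilde\Phi\le(1+\varepsilon)\Phi$ at every moment at which $\mathrm{rk}(E)>0$, and which makes at most $C\cdot\Phi_{\max}^2\cdot\varepsilon^{-4}\cdot\log^3 n$ rank-queries in each update (worst case). 2. There is a deterministic dynamic algorithm with the same approximation guarantee which, for every $T$, makes at most $C\cdot\Phi_{\max}\cdot\varepsilon^{-4}\cdot\log^3 n\cdot T$ rank-queries in total during the first $T$ updates (amortized bound). -/

import Mathlib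

universe u v

namespace DynMatroid

/-- The rank `rk(A)` of a set `A` in `M`, as a natural number: the size of a largest independent
subset of `A`. (All matroids below have a finite ground set. If `A` is not contained in the ground
set `E`, this is the rank of `A ∩ E`.) -/
noncomputable def rk {α : Type u} (M : Matroid α) (A : Set α) : ℕ := (M.eRk A).toNat

/-- The values `|A| / (rk(E) - rk(E \ A))`, over all `A ⊆ E` with `rk(E \ A) < rk(E)`. -/
def packingRatios {α : Type u} (M : Matroid α) : Set ℝ :=
  {x | ∃ A ⊆ M.E, rk M (M.E \ A) < rk M M.E ∧
    x = (A.ncard : ℝ) / ((rk M M.E : ℝ) - (rk M (M.E \ A) : ℝ))}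

/-- The fractional packing number `Φ_M`. For a matroid with finite ground set and positive rank it
is the minimum of a finite nonempty set of reals. In rank `0` there is no admissible set `A` and
`Φ_M` is undefined; it is only used below for matroids of positive rank. -/
noncomputable def packingNumber {α : Type u} (M : Matroid α) : ℝ := sInf (packingRatios M)

/-- The updates of a dynamic matroid, as they are announced to the algorithm. -/
inductive Update (α : Type u) : Type u
  | insert (e : α) : Update α
  | delete (e : α) : Update α

/-- `IsUpdate M u M'`: the update `u` may turn the matroid `M` into the matroid `M'`.
A deletion of `e` keeps the independent sets that avoid `e`. An insertion of `e` adds `e` to the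
ground set, and adds independent sets that all contain `e`, in any way that gives a matroid. -/
def IsUpdate {α : Type u} (M : Matroid α) : Update α → Matroid α → Prop
  | .insert e, M' => e ∉ M.E ∧ M'.E = insert e M.E ∧ ∀ I, e ∉ I → (M'.Indep I ↔ M.Indep I)
  | .delete e, M' => e ∈ M.E ∧ M'.E = M.E \ {e} ∧ ∀ I, M'.Indep I ↔ (M.Indep I ∧ e ∉ I)

/-- `IsDynamicMatroid M u T`: `M 0, …, M T` are the successive states of a dynamic matroid under
the updates `u 0, …, u (T - 1)`. -/
def IsDynamicMatroid {α : Type u} (M : ℕ → Matroid α) (u : ℕ → Update α) (T : ℕ) : Prop :=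
  ∀ t < T, IsUpdate (M t) (u t) (M (t + 1))

/-- At every moment there are at most `n` elements and `Φ ≤ Φmax` (whenever `Φ` is defined). -/
def IsBounded {α : Type u} (n : ℕ) (Φmax : ℝ) (M : ℕ → Matroid α) (T : ℕ) : Prop :=
  ∀ t ≤ T, (M t).E.encard ≤ (n : ℕ∞) ∧ (0 < rk (M t) (M t).E → packingNumber (M t) ≤ Φmax)

/-- A deterministic computation with access to a rank oracle that returns a value in `β`:
it returns a value, or asks for the rank of a set `A` and continues depending on the answer. -/
inductive QueryProg (α : Type u) (β : Type v) : Type (max u v)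
  | done (b : β) : QueryProg α β
  | ask (A : Set α) (next : ℕ → QueryProg α β) : QueryProg α β

/-- The value that a computation returns when its queries are answered by `M`. -/
noncomputable def QueryProg.result {α : Type u} {β : Type v} (M : Matroid α) :
    QueryProg α β → β
  | .done b => b
  | .ask A next => (next (rk M A)).result M

/-- The number of rank-queries of a computation when its queries are answered by `M`. -/
noncomputable def QueryProg.cost {α : Type u} {β : Type v} (M : Matroid α) :
    QueryProg α β → ℕ
  | .done _ => 0
  | .ask A next => (next (rk M A)).cost M + 1

/-- A deterministic dynamic algorithm in the rank-oracle model that maintains a real number.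
It is given the ground set of the initial matroid and sets up its state, then for every update it
is told which element is inserted or deleted and computes its new state. The value that it
maintains is read off its state, without further queries. -/
structure DynAlgorithm (α : Type u) where
  State : Type u
  init : Set α → QueryProg α State
  update : Update α → State → QueryProg α State
  output : State → ℝ

/-- The state after the first `t` updates. The rank-queries made while update `u t` is handled are
answered by the matroid `M (t + 1)` that results from this update. -/
noncomputable def DynAlgorithm.state {α : Type u} (𝒜 : DynAlgorithm α) (M : ℕ → Matroid α)
    (u : ℕ → Update α) : ℕ → 𝒜.State
  | 0 => (𝒜.init (M 0).E).result (M 0)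
  | t + 1 => (𝒜.update (u t) (𝒜.state M u t)).result (M (t + 1))

/-- The value maintained by the algorithm after the first `t` updates. -/
noncomputable def DynAlgorithm.value {α : Type u} (𝒜 : DynAlgorithm α) (M : ℕ → Matroid α)
    (u : ℕ → Update α) (t : ℕ) : ℝ :=
  𝒜.output (𝒜.state M u t)

/-- The number of rank-queries made while update `u t` is handled. -/
noncomputable def DynAlgorithm.queries {α : Type u} (𝒜 : DynAlgorithm α) (M : ℕ → Matroid α)
    (u : ℕ → Update α) (t : ℕ) : ℕ :=
  (𝒜.update (u t) (𝒜.state M u t)).cost (M (t + 1))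

/-- On every dynamic matroid with at most `n` elements and `Φ ≤ Φmax` at any moment, the algorithm
maintains a value in `[(1 - ε) Φ, (1 + ε) Φ]`. -/
def DynAlgorithm.Maintains {α : Type u} (𝒜 : DynAlgorithm α) (ε : ℝ) (n : ℕ) (Φmax : ℝ) : Prop :=
  ∀ (M : ℕ → Matroid α) (u : ℕ → Update α) (T : ℕ),
    IsDynamicMatroid M u T → IsBounded n Φmax M T → ∀ t ≤ T, 0 < rk (M t) (M t).E →
      (1 - ε) * packingNumber (M t) ≤ 𝒜.value M u t ∧
        𝒜.value M u t ≤ (1 + ε) * packingNumber (M t)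

/-- On every such dynamic matroid, every single update takes at most `q` rank-queries. -/
def DynAlgorithm.WorstCaseQueries {α : Type u} (𝒜 : DynAlgorithm α) (n : ℕ) (Φmax q : ℝ) :
    Prop :=
  ∀ (M : ℕ → Matroid α) (u : ℕ → Update α) (T : ℕ),
    IsDynamicMatroid M u T → IsBounded n Φmax M T → ∀ t < T, (𝒜.queries M u t : ℝ) ≤ q

/-- On every such dynamic matroid, the first `T` updates take at most `q * T` rank-queries in
total, for every `T`. -/
def DynAlgorithm.AmortizedQueries {α : Type u} (𝒜 : DynAlgorithm α) (n : ℕ) (Φmax q : ℝ) :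
    Prop :=
  ∀ (M : ℕ → Matroid α) (u : ℕ → Update α) (T : ℕ),
    IsDynamicMatroid M u T → IsBounded n Φmax M T →
      ∑ t ∈ Finset.range T, (𝒜.queries M u t : ℝ) ≤ q * T

end DynMatroid

/-!
# Maintaining the fractional packing number of a dynamic matroid

A greedy packing repeatedly takes a minimum-weight basis, the weight of an element being its load,
the number of bases that contain it so far; ties are broken by a fixed well-order. Elements whose
load has reached a cap `K` are left out. Let `τ` be the first round after which some load equals
`K`. Then `τ / K` approximates `Φ`. It is at most `Φ`, since a set `A` meets each basis in at least
`rk E - rk (E \ A)` elements (`round_le_mul_packingNumber`). For the lower bound, the potential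
`∑ x, (1 + ε) ^ load x` grows by a factor of at most `1 + ε / Φ` in each round, because a greedy
basis carries at most a `1 / Φ` fraction of it (`sum_one_add_pow_load_le`). Taking logarithms,
`K ≥ 2 log n / ε²` gives `τ / K ≥ (1 - ε) Φ` (`mul_packingNumber_le_round`). In particular
`N > K Φmax` rounds suffice.

An update compares the packings of a matroid and of the deletion of one element `e` from it.
Deleting `e` never decreases the load of another element, and the bases do not become larger; so
the loads of the other elements increase by at most the load of `e` in total, hence by at most `K`
(`ncard_load_lt_load_delete_le`). Only elements whose load differs can enter the basis (insertion)
or leave it (deletion). In every round the new basis is therefore enclosed by known sets `P` and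
`Q`, one of which differs from it in at most `K + 1` elements, and it consists of `P` and of the rank
jumps along the sorted list of `Q \ P` (`greedy_eq_union`). Bisection finds them with
`2 + (K + 1) ⌈log₂ n⌉` queries (`cost_findGreedy_le`). An update thus takes
`O(N K log n) = O(Φmax ε⁻⁴ log³ n)` queries in the worst case, which implies both bounds if
`Φmax ≥ 1`. As `Φ ≥ 1` always, the remaining cases need no queries.
-/

namespace DynMatroid

open Set

variable {α : Type u}

/-! ### The rank function -/

theorem coe_rk (M : Matroid α) [M.Finite] (A : Set α) : (rk M A : ℕ∞) = M.eRk A :=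
  ENat.natCast_toNat (Matroid.eRk_ne_top_iff.2 (Matroid.RankFinite.isRkFinite A))

theorem rk_mono (M : Matroid α) [M.Finite] {A B : Set α} (h : A ⊆ B) : rk M A ≤ rk M B := by
  have := M.eRk_mono h
  rw [← coe_rk, ← coe_rk] at this
  exact_mod_cast this

theorem rk_insert_of_mem (M : Matroid α) [M.Finite] {A : Set α} {x : α} (hx : x ∈ M.closure A) :
    rk M (insert x A) = rk M A := by
  rw [rk, rk, ← M.eRk_insert_closure_eq, insert_eq_of_mem hx, M.eRk_closure_eq]

theorem rk_insert_of_notMem (M : Matroid α) [M.Finite] {A : Set α} {x : α} (hxE : x ∈ M.E)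
    (hx : x ∉ M.closure A) : rk M (insert x A) = rk M A + 1 := by
  have := M.eRk_insert_eq_add_one (X := A) (e := x) ⟨hxE, hx⟩
  rw [← coe_rk, ← coe_rk] at this
  exact_mod_cast this

theorem rk_insert_le (M : Matroid α) [M.Finite] (A : Set α) (x : α) :
    rk M (insert x A) ≤ rk M A + 1 := by
  have := M.eRk_insert_le_add_one x A
  rw [← coe_rk, ← coe_rk] at this
  exact_mod_cast this

theorem rk_eq_ncard_of_isBasis (M : Matroid α) [M.Finite] {I A : Set α} (h : M.IsBasis I A) :
    rk M A = I.ncard := by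
  rw [rk, h.eRk_eq_encard, Set.ncard_def]

theorem rk_union_le_add_ncard (M : Matroid α) [M.Finite] {A B : Set α} (hB : B.Finite) :
    rk M (A ∪ B) ≤ rk M A + B.ncard := by
  have := M.eRk_union_le_eRk_add_encard A B
  rw [← coe_rk, ← coe_rk, ← hB.cast_ncard_eq] at this
  exact_mod_cast this

/-! ### Greedy bases -/

section Greedy

/-- The weight of an element, with ties between equal weights broken by the order of `α`. -/
def key (w : α → ℕ) (x : α) : ℕ ×ₗ α := toLex (w x, x)

theorem key_injective (w : α → ℕ) : Function.Injective (key w) := fun _ _ h =>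
  congrArg (fun p => (ofLex p).2) h

variable [LinearOrder α]

theorem key_lt_key {w : α → ℕ} {x y : α} : key w x < key w y ↔ w x < w y ∨ w x = w y ∧ x < y :=
  Prod.Lex.toLex_lt_toLex

theorem weight_le_of_key_lt {w : α → ℕ} {x y : α} (h : key w x < key w y) : w x ≤ w y := by
  rcases key_lt_key.1 h with h | h
  · exact h.le
  · exact h.1.le

/-- The elements of `M` that the greedy procedure for the weights `w` treats before `x`. -/
def earlier (M : Matroid α) (w : α → ℕ) (x : α) : Set α := {y ∈ M.E | key w y < key w x}

/-- The result of the greedy procedure on the elements of weight less than `K`: the minimum-weight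
basis of `{x ∈ E | w x < K}`, ties being broken by the order of `α`. -/
def greedy (M : Matroid α) (K : ℕ) (w : α → ℕ) : Set α :=
  {x ∈ M.E | w x < K ∧ x ∉ M.closure (earlier M w x)}

theorem greedy_subset_ground (M : Matroid α) (K : ℕ) (w : α → ℕ) : greedy M K w ⊆ M.E :=
  fun _ h => h.1

theorem greedy_indep (M : Matroid α) [M.Finite] (K : ℕ) (w : α → ℕ) :
    M.Indep (greedy M K w) := by
  have key_step : ∀ s : Finset α, (s : Set α) ⊆ greedy M K w → M.Indep s := by
    intro s
    induction s using Finset.induction_on_max_value (key w) with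
    | empty => simp
    | insert a s ha hmax ih =>
      intro hs
      rw [Finset.coe_insert, insert_subset_iff] at hs
      have hsI := ih hs.2
      rw [Finset.coe_insert]
      refine ((hsI.notMem_closure_iff hs.1.1).1 fun h => hs.1.2.2 ?_).1
      refine M.closure_subset_closure (fun y hy => ?_) h
      refine ⟨(hs.2 hy).1, lt_of_le_of_ne (hmax y hy) fun h => ha ?_⟩
      rwa [← key_injective w h]
  have hfin : (greedy M K w).Finite := M.ground_finite.subset (greedy_subset_ground M K w)
  simpa using key_step hfin.toFinset (by simp)

variable [WellFoundedLT α]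

/-- The greedy elements up to `x` span `x`. -/
theorem mem_closure_greedy (M : Matroid α) {K : ℕ} {w : α → ℕ} {x : α} (hx : x ∈ M.E)
    (hw : w x < K) : x ∈ M.closure (greedy M K w ∩ {y | key w y ≤ key w x}) := by
  induction x using (InvImage.wf (key w) wellFounded_lt).induction with
  | _ x ih =>
    by_cases hG : x ∈ greedy M K w
    · exact M.mem_closure_of_mem' ⟨hG, le_refl (key w x)⟩ hx
    · have hcl : x ∈ M.closure (earlier M w x) := by
        by_contra h
        exact hG ⟨hx, hw, h⟩
      refine M.closure_subset_closure_of_subset_closure (fun y hy => ?_) hcl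
      refine M.closure_subset_closure ?_
        (ih y hy.2 hy.1 ((weight_le_of_key_lt hy.2).trans_lt hw))
      exact inter_subset_inter_right _ fun z hz => le_trans hz hy.2.le

/-- Among the elements of weight less than `t ≤ K`, the greedy basis has full rank. -/
theorem isBasis_greedy_inter (M : Matroid α) [M.Finite] {K t : ℕ} (ht : t ≤ K) (w : α → ℕ) :
    M.IsBasis (greedy M K w ∩ {x | w x < t}) {x ∈ M.E | w x < t} := by
  rw [Matroid.isBasis_iff_indep_subset_closure]
  refine ⟨(greedy_indep M K w).subset inter_subset_left, fun x hx => ⟨hx.1.1, hx.2⟩, ?_⟩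
  intro x hx
  refine M.closure_subset_closure ?_ (mem_closure_greedy M (K := K) hx.1 (hx.2.trans_le ht))
  rintro y ⟨hy, hyx⟩
  refine ⟨hy, ?_⟩
  rcases eq_or_lt_of_le (show key w y ≤ key w x from hyx) with h | h
  · rw [key_injective w h]; exact hx.2
  · exact (weight_le_of_key_lt h).trans_lt hx.2

theorem isBasis_greedy (M : Matroid α) [M.Finite] (K : ℕ) (w : α → ℕ) :
    M.IsBasis (greedy M K w) {x ∈ M.E | w x < K} := by
  have h := isBasis_greedy_inter M le_rfl (K := K) w
  rwa [inter_eq_left.2 fun x hx => hx.2.1] at h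

/-- The greedy basis is the result of a greedy procedure that starts from any of its subsets `P`
and looks only at the elements of a set `Q` that contains it. -/
theorem greedy_eq_union (M : Matroid α) [M.Finite] {K : ℕ} {w : α → ℕ} {P Q : Set α}
    (hP : P ⊆ greedy M K w) (hGQ : greedy M K w ⊆ Q) (hQ : Q ⊆ {x ∈ M.E | w x < K}) :
    greedy M K w =
      P ∪ {x ∈ Q \ P | x ∉ M.closure (P ∪ {y ∈ Q \ P | key w y < key w x})} := by
  have hspan : ∀ x, w x < K →
      earlier M w x ⊆ M.closure (greedy M K w ∩ {y | key w y < key w x}) := by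
    intro x hx y hy
    refine M.closure_subset_closure ?_
      (mem_closure_greedy M hy.1 ((weight_le_of_key_lt hy.2).trans_lt hx))
    exact inter_subset_inter_right _ fun z hz => lt_of_le_of_lt hz hy.2
  ext x
  constructor
  · intro hx
    by_cases hxP : x ∈ P
    · exact Or.inl hxP
    refine Or.inr ⟨⟨hGQ hx, hxP⟩, fun hcl => ?_⟩
    refine (greedy_indep M K w).notMem_closure_sdiff_of_mem hx ?_
    refine M.closure_subset_closure_of_subset_closure ?_ hcl
    rintro y (hy | ⟨hy, hyx⟩)
    · refine M.mem_closure_of_mem' ⟨hP hy, ?_⟩ (hP hy).1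
      rintro rfl
      exact hxP hy
    · refine M.closure_subset_closure ?_ (hspan x hx.2.1 ⟨(hQ hy.1).1, hyx⟩)
      rintro z ⟨hz, hzx⟩
      exact ⟨hz, fun h => (ne_of_lt hzx) (congrArg (key w) h)⟩
  · rintro (hx | ⟨hx, hcl⟩)
    · exact hP hx
    refine ⟨(hQ hx.1).1, (hQ hx.1).2, fun h => hcl ?_⟩
    refine M.closure_subset_closure ?_ (M.closure_subset_closure_of_subset_closure
      (hspan x (hQ hx.1).2) h)
    rintro y ⟨hy, hyx⟩
    by_cases hyP : y ∈ P
    · exact Or.inl hyP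
    · exact Or.inr ⟨⟨hGQ hy, hyP⟩, hyx⟩

end Greedy

/-! ### Loads of the greedy packing -/

section Load

variable [LinearOrder α]

open Classical in
/-- The loads after `i` rounds of the greedy packing with cap `K`. Every round takes the greedy
basis with respect to the current loads, of the elements whose load is still less than `K`, and
raises the load of its elements by one. -/
noncomputable def load (M : Matroid α) (K : ℕ) : ℕ → α → ℕ
  | 0 => fun _ => 0
  | i + 1 => fun x => load M K i x + if x ∈ greedy M K (load M K i) then 1 else 0

/-- The basis that the greedy packing takes in round `i`. -/
noncomputable def packing (M : Matroid α) (K i : ℕ) : Set α := greedy M K (load M K i)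

open Classical in
theorem load_succ (M : Matroid α) (K i : ℕ) (x : α) :
    load M K (i + 1) x = load M K i x + if x ∈ packing M K i then 1 else 0 := rfl

theorem load_le_cap (M : Matroid α) (K i : ℕ) (x : α) : load M K i x ≤ K := by
  induction i with
  | zero => exact Nat.zero_le _
  | succ i ih =>
    rw [load_succ]
    split_ifs with h
    · exact h.2.1
    · exact ih

theorem load_eq_zero_of_notMem (M : Matroid α) (K i : ℕ) {x : α} (hx : x ∉ M.E) :
    load M K i x = 0 := by
  induction i with
  | zero => rfl
  | succ i ih => rw [load_succ, ih, if_neg fun h => hx h.1]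

open Classical in
theorem sum_load_succ (M : Matroid α) [M.Finite] (K i : ℕ) (s : Finset α) :
    ∑ x ∈ s, load M K (i + 1) x =
      ∑ x ∈ s, load M K i x + ((packing M K i) ∩ s).ncard := by
  simp_rw [load_succ, Finset.sum_add_distrib, Finset.sum_boole]
  congr 1
  rw [← Set.ncard_coe_finset, Finset.coe_filter, inter_comm]
  rfl

/-! ### Deleting one element -/

/-- If deleting `e` is accompanied by an increase of weights, an element of the greedy basis whose own
weight is unchanged stays in it: fewer elements are treated before it. -/
theorem mem_greedy_delete (L : Matroid α) {e x : α} {K : ℕ} {w w' : α → ℕ}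
    (hw : ∀ y ∈ (L.delete {e}).E, w y ≤ w' y) (hxE : x ∈ (L.delete {e}).E) (hx : w x = w' x)
    (hxG : x ∈ greedy L K w) : x ∈ greedy (L.delete {e}) K w' := by
  refine ⟨hxE, hx ▸ hxG.2.1, fun h => hxG.2.2 ?_⟩
  rw [Matroid.delete_closure_eq] at h
  refine L.closure_subset_closure ?_ h.1
  rintro y ⟨⟨hyE, hy⟩, -⟩
  refine ⟨hyE.1, ?_⟩
  have := hw y hyE
  rw [key_lt_key] at hy ⊢
  grind

theorem load_le_load_delete (L : Matroid α) (e : α) (K i : ℕ) :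
    ∀ x ∈ (L.delete {e}).E, load L K i x ≤ load (L.delete {e}) K i x := by
  induction i with
  | zero => exact fun _ _ => le_rfl
  | succ i ih =>
    intro x hx
    rw [load_succ, load_succ]
    rcases (ih x hx).lt_or_eq with h | h
    · split_ifs <;> omega
    · have : x ∈ packing L K i → x ∈ packing (L.delete {e}) K i := mem_greedy_delete L ih hx h
      split_ifs <;> first | omega | tauto

variable [WellFoundedLT α]

theorem ncard_packing_delete_le (L : Matroid α) [L.Finite] (e : α) (K i : ℕ) :
    (packing (L.delete {e}) K i).ncard ≤ (packing L K i).ncard := by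
  have : (L.delete {e}).Finite := ⟨L.ground_finite.subset (L.delete_subset_ground _)⟩
  have h1 := rk_eq_ncard_of_isBasis _ (isBasis_greedy L K (load L K i))
  have h2 := rk_eq_ncard_of_isBasis _
    (isBasis_greedy (L.delete {e}) K (load (L.delete {e}) K i)).of_delete
  rw [packing, packing, ← h1, ← h2]
  refine rk_mono L fun x hx => ⟨hx.1.1, ?_⟩
  exact (load_le_load_delete L e K i x hx.1).trans_lt hx.2

/-- A deletion does not increase the total load, because no basis becomes larger. Hence the load
outside `e` increases by at most the load of `e`. -/
theorem sum_load_delete_le (L : Matroid α) [L.Finite] (e : α) (K i : ℕ) (s : Finset α)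
    (hs : (s : Set α) = (L.delete {e}).E) (he : e ∉ s) :
    ∑ x ∈ s, load (L.delete {e}) K i x ≤ ∑ x ∈ s, load L K i x + load L K i e := by
  classical
  have : (L.delete {e}).Finite := ⟨L.ground_finite.subset (L.delete_subset_ground _)⟩
  rw [add_comm, ← Finset.sum_insert (f := load L K i) he]
  induction i with
  | zero => simp [load]
  | succ i ih =>
    rw [sum_load_succ, sum_load_succ]
    refine add_le_add ih ?_
    rw [hs, inter_eq_left.2 (show packing (L.delete {e}) K i ⊆ _ from greedy_subset_ground _ _ _),
      inter_eq_left.2]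
    · exact ncard_packing_delete_le L e K i
    · refine (greedy_subset_ground _ _ _).trans fun x hx => ?_
      by_cases hxe : x = e
      · simp [hxe]
      · rw [Finset.coe_insert, hs]
        exact Or.inr ⟨hx, hxe⟩

/-- Deleting one element changes the load of at most `K` elements: loads can only increase, and
their total increases by at most the load of the deleted element. -/
theorem ncard_load_lt_load_delete_le (L : Matroid α) [L.Finite] (e : α) (K i : ℕ) :
    {x ∈ (L.delete {e}).E | load L K i x < load (L.delete {e}) K i x}.ncard ≤ K := by
  classical
  have hfin : (L.delete {e}).E.Finite := L.ground_finite.subset (L.delete_subset_ground _)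
  have hs : (hfin.toFinset : Set α) = (L.delete {e}).E := hfin.coe_toFinset
  have he : e ∉ hfin.toFinset := by simp
  have h1 := sum_load_delete_le L e K i hfin.toFinset hs he
  have h2 := load_le_cap L K i e
  have h3 : ∑ x ∈ hfin.toFinset, (load L K i x +
      if load L K i x < load (L.delete {e}) K i x then 1 else 0) ≤
      ∑ x ∈ hfin.toFinset, load (L.delete {e}) K i x := by
    refine Finset.sum_le_sum fun x hx => ?_
    have := load_le_load_delete L e K i x (hfin.mem_toFinset.1 hx)
    split_ifs <;> omega
  rw [Finset.sum_add_distrib, Finset.sum_boole] at h3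
  have h4 : {x ∈ (L.delete {e}).E | load L K i x < load (L.delete {e}) K i x} =
      ((hfin.toFinset.filter fun x => load L K i x < load (L.delete {e}) K i x : Finset α)
        : Set α) := by
    ext x; simp
  rw [h4, Set.ncard_coe_finset]
  simp only [Nat.cast_id] at h3
  omega

end Load

/-! ### Sequential composition of query programs -/

section Bind

universe v₁ v₂
variable {β : Type v₁} {γ : Type v₂}

/-- Run a query program, and continue with a program that depends on the value it returns. -/
def QueryProg.bind : QueryProg α β → (β → QueryProg α γ) → QueryProg α γ
  | .done b, f => f b
  | .ask A next, f => .ask A fun m => (next m).bind f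

theorem QueryProg.result_bind (M : Matroid α) (p : QueryProg α β) (f : β → QueryProg α γ) :
    (p.bind f).result M = (f (p.result M)).result M := by
  induction p with
  | done b => rfl
  | ask A next ih => exact ih _

theorem QueryProg.cost_bind (M : Matroid α) (p : QueryProg α β) (f : β → QueryProg α γ) :
    (p.bind f).cost M = p.cost M + (f (p.result M)).cost M := by
  induction p with
  | done b => simp [bind, cost, result]
  | ask A next ih =>
    simp only [bind, cost, result]
    rw [ih]
    omega

end Bind

/-! ### Finding the rank jumps along a list by bisection -/

/-- The members of a list that increase the rank when the list is added to `S` one by one. -/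
def jumps (M : Matroid α) : Set α → List α → Set α
  | _, [] => ∅
  | S, x :: l => {y | y = x ∧ x ∉ M.closure S} ∪ jumps M (insert x S) l

theorem union_setOf_mem_cons (S : Set α) (x : α) (l : List α) :
    S ∪ {y | y ∈ x :: l} = insert x S ∪ {y | y ∈ l} := by
  ext y; simp only [List.mem_cons, mem_union, mem_ofPred_eq, mem_insert_iff]; tauto

theorem jumps_append (M : Matroid α) (S : Set α) (l₁ l₂ : List α) :
    jumps M S (l₁ ++ l₂) = jumps M S l₁ ∪ jumps M (S ∪ {x | x ∈ l₁}) l₂ := by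
  induction l₁ generalizing S with
  | nil => simp [jumps]
  | cons x l ih => rw [List.cons_append, jumps, jumps, ih, union_setOf_mem_cons, union_assoc]

theorem rk_union_list_le (M : Matroid α) [M.Finite] (S : Set α) (l : List α) :
    rk M (S ∪ {x | x ∈ l}) ≤ rk M S + l.length := by
  induction l generalizing S with
  | nil => simp
  | cons x l ih =>
    rw [union_setOf_mem_cons, List.length_cons]
    have := ih (insert x S)
    have := rk_insert_le M S x
    omega

theorem jumps_eq_empty (M : Matroid α) [M.Finite] (S : Set α) (l : List α)
    (hl : ∀ x ∈ l, x ∈ M.E) (h : rk M (S ∪ {x | x ∈ l}) = rk M S) : jumps M S l = ∅ := by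
  induction l generalizing S with
  | nil => rfl
  | cons x l ih =>
    rw [List.forall_mem_cons] at hl
    rw [union_setOf_mem_cons] at h
    have h1 : rk M (insert x S) ≤ rk M (insert x S ∪ {y | y ∈ l}) := rk_mono M subset_union_left
    have h2 : rk M S ≤ rk M (insert x S) := rk_mono M (subset_insert x S)
    rw [jumps, ih _ hl.2 (by omega), union_empty, eq_empty_iff_forall_notMem]
    rintro y ⟨rfl, hy⟩
    have := rk_insert_of_notMem M hl.1 hy
    omega

theorem jumps_eq_all (M : Matroid α) [M.Finite] (S : Set α) (l : List α)
    (h : rk M (S ∪ {x | x ∈ l}) = rk M S + l.length) : jumps M S l = {x | x ∈ l} := by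
  induction l generalizing S with
  | nil => simp [jumps]
  | cons x l ih =>
    rw [union_setOf_mem_cons, List.length_cons] at h
    have h1 := rk_union_list_le M (insert x S) l
    have h2 := rk_insert_le M S x
    have hx : x ∉ M.closure S := fun hx => by
      have := rk_insert_of_mem M hx
      omega
    rw [jumps, ih _ (by omega)]
    ext y
    simp [hx]

theorem jumps_eq_of_pairwise [LinearOrder α] (M : Matroid α) (w : α → ℕ) (S : Set α)
    (l : List α) (hl : l.Pairwise fun x y => key w x < key w y) :
    jumps M S l =
      {x | x ∈ l ∧ x ∉ M.closure (S ∪ {y | y ∈ l ∧ key w y < key w x})} := by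
  induction l generalizing S with
  | nil => simp [jumps]
  | cons a l ih =>
    rw [List.pairwise_cons] at hl
    rw [jumps, ih _ hl.2]
    ext x
    simp only [mem_union, mem_ofPred_eq, List.mem_cons]
    have hfirst : {y | (y = a ∨ y ∈ l) ∧ key w y < key w a} = ∅ := by
      rw [eq_empty_iff_forall_notMem]
      rintro y ⟨rfl | hy, hya⟩
      · exact lt_irrefl _ hya
      · exact lt_asymm hya (hl.1 y hy)
    have hrest : x ∈ l → S ∪ {y | (y = a ∨ y ∈ l) ∧ key w y < key w x} =
        insert a S ∪ {y | y ∈ l ∧ key w y < key w x} := by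
      intro hx
      have := hl.1 x hx
      ext y
      simp only [mem_union, mem_ofPred_eq, mem_insert_iff]
      constructor
      · tauto
      · rintro ((rfl | h) | h)
        · exact Or.inr ⟨Or.inl rfl, this⟩
        · exact Or.inl h
        · exact Or.inr ⟨Or.inr h.1, h.2⟩
    constructor
    · rintro (⟨rfl, hx⟩ | ⟨hx, hcl⟩)
      · exact ⟨Or.inl rfl, by rwa [hfirst, union_empty]⟩
      · exact ⟨Or.inr hx, by rwa [hrest hx]⟩
    · rintro ⟨rfl | hx, hcl⟩
      · rw [hfirst, union_empty] at hcl
        exact Or.inl ⟨rfl, hcl⟩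
      · rw [hrest hx] at hcl
        exact Or.inr ⟨hx, hcl⟩

/-- Finds the rank jumps along the list `l`, starting from `S`, given the ranks `a` and `b` of `S`
and of `S ∪ l`. A part of the list on which the rank is constant, or increases at every member,
needs no query; any other part is halved. The first argument bounds the depth of the recursion. -/
noncomputable def bisect : ℕ → Set α → ℕ → List α → ℕ → QueryProg α (Set α)
  | 0, _, a, l, b => .done (if b = a then ∅ else {x | x ∈ l})
  | d + 1, S, a, l, b =>
    if b = a then .done ∅
    else if b = a + l.length then .done {x | x ∈ l}
    else .ask (S ∪ {x | x ∈ l.take (l.length / 2)}) fun m =>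
      (bisect d S a (l.take (l.length / 2)) m).bind fun X =>
        (bisect d (S ∪ {x | x ∈ l.take (l.length / 2)}) m (l.drop (l.length / 2)) b).bind
          fun Y => .done (X ∪ Y)

theorem union_take_union_drop (S : Set α) (l : List α) (k : ℕ) :
    S ∪ {x | x ∈ l.take k} ∪ {x | x ∈ l.drop k} = S ∪ {x | x ∈ l} := by
  conv_rhs => rw [← List.take_append_drop k l]
  ext x
  simp only [mem_union, mem_ofPred_eq, List.mem_append, or_assoc]

theorem result_bisect (M : Matroid α) [M.Finite] (d : ℕ) (S : Set α) (l : List α)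
    (hl : ∀ x ∈ l, x ∈ M.E) (hd : l.length ≤ 2 ^ d) :
    (bisect d S (rk M S) l (rk M (S ∪ {x | x ∈ l}))).result M = jumps M S l := by
  induction d generalizing S l with
  | zero =>
    rw [bisect, QueryProg.result]
    split_ifs with h
    · exact (jumps_eq_empty M S l hl h).symm
    · have h1 := rk_union_list_le M S l
      have h2 : rk M S ≤ rk M (S ∪ {x | x ∈ l}) := rk_mono M subset_union_left
      exact (jumps_eq_all M S l (by omega)).symm
  | succ d ih =>
    rw [bisect]
    split_ifs with h h'
    · exact (jumps_eq_empty M S l hl h).symm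
    · exact (jumps_eq_all M S l h').symm
    · rw [QueryProg.result, QueryProg.result_bind, QueryProg.result_bind, QueryProg.result]
      rw [ih S _ (fun x hx => hl x (List.mem_of_mem_take hx))
        (by rw [List.length_take]; omega), ← union_take_union_drop S l (l.length / 2),
        ih _ _ (fun x hx => hl x (List.mem_of_mem_drop hx)) (by rw [List.length_drop]; omega),
        ← jumps_append, List.take_append_drop]

/-- A part of the list is halved only if it contains a rank jump, so every jump accounts for at most
one query at each depth. -/
theorem cost_bisect_le_rank (M : Matroid α) [M.Finite] (d : ℕ) (S : Set α) (l : List α) :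
    (bisect d S (rk M S) l (rk M (S ∪ {x | x ∈ l}))).cost M ≤
      (rk M (S ∪ {x | x ∈ l}) - rk M S) * d := by
  induction d generalizing S l with
  | zero => simp [bisect, QueryProg.cost]
  | succ d ih =>
    rw [bisect]
    split_ifs with h h'
    · exact Nat.zero_le _
    · exact Nat.zero_le _
    · rw [QueryProg.cost, QueryProg.cost_bind, QueryProg.cost_bind, QueryProg.cost]
      have h1 := ih S (l.take (l.length / 2))
      have h2 := ih (S ∪ {x | x ∈ l.take (l.length / 2)}) (l.drop (l.length / 2))
      rw [union_take_union_drop] at h2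
      have h3 : rk M S ≤ rk M (S ∪ {x | x ∈ l.take (l.length / 2)}) :=
        rk_mono M subset_union_left
      have h4 : rk M (S ∪ {x | x ∈ l.take (l.length / 2)}) ≤ rk M (S ∪ {x | x ∈ l}) :=
        rk_mono M (union_subset_union_right _ fun x hx => List.mem_of_mem_take hx)
      generalize rk M (S ∪ {x | x ∈ l.take (l.length / 2)}) = m at *
      obtain ⟨p, rfl⟩ := Nat.exists_eq_add_of_le h3
      obtain ⟨q, hq⟩ := Nat.exists_eq_add_of_le h4
      rw [hq] at h h2 ⊢
      rw [show rk M S + p + q - rk M S = p + q by omega]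
      rw [show rk M S + p - rk M S = p by omega] at h1
      rw [show rk M S + p + q - (rk M S + p) = q by omega] at h2
      have : 1 ≤ p + q := by omega
      linarith

/-- A part of the list is halved only if it has a member at which the rank does not jump, so every
such member accounts for at most one query at each depth. -/
theorem cost_bisect_le_nullity (M : Matroid α) [M.Finite] (d : ℕ) (S : Set α) (l : List α) :
    (bisect d S (rk M S) l (rk M (S ∪ {x | x ∈ l}))).cost M ≤
      (rk M S + l.length - rk M (S ∪ {x | x ∈ l})) * d := by
  induction d generalizing S l with
  | zero => simp [bisect, QueryProg.cost]
  | succ d ih =>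
    rw [bisect]
    split_ifs with h h'
    · exact Nat.zero_le _
    · exact Nat.zero_le _
    · rw [QueryProg.cost, QueryProg.cost_bind, QueryProg.cost_bind, QueryProg.cost]
      have h1 := ih S (l.take (l.length / 2))
      have h2 := ih (S ∪ {x | x ∈ l.take (l.length / 2)}) (l.drop (l.length / 2))
      rw [union_take_union_drop] at h2
      have h3 := rk_union_list_le M S (l.take (l.length / 2))
      have h4 := rk_union_list_le M (S ∪ {x | x ∈ l.take (l.length / 2)})
        (l.drop (l.length / 2))
      rw [union_take_union_drop] at h4
      have h5 : (l.take (l.length / 2)).length + (l.drop (l.length / 2)).length = l.length := by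
        rw [← List.length_append, List.take_append_drop]
      generalize rk M (S ∪ {x | x ∈ l.take (l.length / 2)}) = m at *
      generalize (l.take (l.length / 2)).length = l₁ at *
      generalize (l.drop (l.length / 2)).length = l₂ at *
      obtain ⟨p, hp⟩ := Nat.exists_eq_add_of_le h3
      obtain ⟨q, hq⟩ := Nat.exists_eq_add_of_le h4
      rw [show rk M S + l.length - rk M (S ∪ {x | x ∈ l}) = p + q by omega]
      rw [show rk M S + l₁ - m = p by omega] at h1
      rw [show m + l₂ - rk M (S ∪ {x | x ∈ l}) = q by omega] at h2
      have : 1 ≤ p + q := by omega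
      linarith

/-! ### Recomputing the packing -/

section Rebuild

variable [LinearOrder α]

theorem exists_sorted_list (w : α → ℕ) {A : Set α} (hA : A.Finite) :
    ∃ l : List α, (l.Pairwise fun x y => key w x < key w y) ∧ {x | x ∈ l} = A := by
  let : LinearOrder α := LinearOrder.lift' (key w) (key_injective w)
  refine ⟨hA.toFinset.sort, hA.toFinset.sortedLT_sort.pairwise, ?_⟩
  ext x
  simp

open Classical in
/-- The elements of a finite set in the order of their keys. -/
noncomputable def sortedList (w : α → ℕ) (A : Set α) : List α :=
  if hA : A.Finite then (exists_sorted_list w hA).choose else []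

theorem pairwise_sortedList (w : α → ℕ) {A : Set α} (hA : A.Finite) :
    (sortedList w A).Pairwise fun x y => key w x < key w y := by
  rw [sortedList, dif_pos hA]
  exact (exists_sorted_list w hA).choose_spec.1

theorem setOf_mem_sortedList (w : α → ℕ) {A : Set α} (hA : A.Finite) :
    {x | x ∈ sortedList w A} = A := by
  rw [sortedList, dif_pos hA]
  exact (exists_sorted_list w hA).choose_spec.2

theorem length_sortedList (w : α → ℕ) {A : Set α} (hA : A.Finite) :
    (sortedList w A).length = A.ncard := by
  classical
  have hnd : (sortedList w A).Nodup :=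
    (pairwise_sortedList w hA).imp fun h => fun he => (ne_of_lt h) (congrArg (key w) he)
  conv_rhs => rw [← setOf_mem_sortedList w hA]
  rw [← List.toFinset_card_of_nodup hnd, ← Set.ncard_coe_finset, List.coe_toFinset]

/-- Computes the greedy basis `B` for the weights `w` from sets `P ⊆ B ⊆ Q`. -/
noncomputable def findGreedy (d : ℕ) (w : α → ℕ) (P Q : Set α) : QueryProg α (Set α) :=
  .ask P fun a => .ask Q fun b =>
    (bisect d P a (sortedList w (Q \ P)) b).bind fun X => .done (P ∪ X)

variable [WellFoundedLT α]

theorem result_findGreedy (M : Matroid α) [M.Finite] {K d : ℕ} {w : α → ℕ} {P Q : Set α}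
    (hP : P ⊆ greedy M K w) (hGQ : greedy M K w ⊆ Q) (hQ : Q ⊆ {x ∈ M.E | w x < K})
    (hd : M.E.ncard ≤ 2 ^ d) : (findGreedy d w P Q).result M = greedy M K w := by
  have hQE : Q \ P ⊆ M.E := fun x hx => (hQ hx.1).1
  have hfin : (Q \ P).Finite := M.ground_finite.subset hQE
  have hset := setOf_mem_sortedList w hfin
  rw [findGreedy, QueryProg.result, QueryProg.result, QueryProg.result_bind, QueryProg.result]
  have h := result_bisect M d P (sortedList w (Q \ P)) (fun x hx => hQE (hset ▸ hx))
    ((length_sortedList w hfin).trans_le ((ncard_le_ncard hQE M.ground_finite).trans hd))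
  rw [hset, union_sdiff_cancel (hP.trans hGQ)] at h
  rw [h, jumps_eq_of_pairwise M w P _ (pairwise_sortedList w hfin),
    greedy_eq_union M hP hGQ hQ]
  have hmem : ∀ x, x ∈ sortedList w (Q \ P) ↔ x ∈ Q \ P := fun x => by
    conv_rhs => rw [← hset]
    rfl
  simp_rw [hmem]

/-- Few queries are needed if one of the two enclosing sets is close to the greedy basis. -/
theorem cost_findGreedy_le (M : Matroid α) [M.Finite] {K c d : ℕ} {w : α → ℕ} {P Q : Set α}
    (hP : P ⊆ greedy M K w) (hGQ : greedy M K w ⊆ Q) (hQ : Q ⊆ {x ∈ M.E | w x < K})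
    (hc : (greedy M K w).ncard ≤ P.ncard + c ∨ Q.ncard ≤ (greedy M K w).ncard + c) :
    (findGreedy d w P Q).cost M ≤ 2 + c * d := by
  have hQE : Q ⊆ M.E := fun x hx => (hQ hx).1
  have hfin : (Q \ P).Finite := M.ground_finite.subset (sdiff_subset.trans hQE)
  have hset := setOf_mem_sortedList w hfin
  have hlen := length_sortedList w hfin
  have hPQ : P ⊆ Q := hP.trans hGQ
  have hrP : rk M P = P.ncard :=
    rk_eq_ncard_of_isBasis M ((greedy_indep M K w).subset hP).isBasis_self
  have hrQ : rk M Q = (greedy M K w).ncard :=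
    rk_eq_ncard_of_isBasis M ((isBasis_greedy M K w).isBasis_subset hGQ hQ)
  have hncard : (Q \ P).ncard + P.ncard = Q.ncard :=
    ncard_sdiff_add_ncard_of_subset hPQ (M.ground_finite.subset hQE)
  have h1 := cost_bisect_le_rank M d P (sortedList w (Q \ P))
  have h2 := cost_bisect_le_nullity M d P (sortedList w (Q \ P))
  rw [hset, union_sdiff_cancel hPQ, hrP, hrQ] at h1 h2
  rw [findGreedy, QueryProg.cost, QueryProg.cost, QueryProg.cost_bind, QueryProg.cost,
    hrP, hrQ]
  have : (bisect d P P.ncard (sortedList w (Q \ P)) (greedy M K w).ncard).cost M ≤ c * d := by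
    rcases hc with hc | hc
    · exact h1.trans (Nat.mul_le_mul_right _ (by omega))
    · exact h2.trans (Nat.mul_le_mul_right _ (by omega))
  omega

open Classical in
/-- The number of sets among `J 0, …, J (i - 1)` that contain `x`. -/
noncomputable def multiplicity (J : ℕ → Set α) (i : ℕ) (x : α) : ℕ :=
  ((Finset.range i).filter fun j => x ∈ J j).card

omit [LinearOrder α] [WellFoundedLT α] in
theorem multiplicity_congr {J J' : ℕ → Set α} {i : ℕ} (h : ∀ j < i, J j = J' j) :
    multiplicity J i = multiplicity J' i := by
  classical
  funext x
  unfold multiplicity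
  congr 1
  refine Finset.filter_congr fun j hj => ?_
  rw [h j (Finset.mem_range.1 hj)]

omit [WellFoundedLT α] in
theorem load_eq_multiplicity (M : Matroid α) (K i : ℕ) :
    load M K i = multiplicity (packing M K) i := by
  classical
  funext x
  induction i with
  | zero => rfl
  | succ i ih =>
    rw [load_succ, ih, multiplicity, multiplicity, Finset.range_add_one, Finset.filter_insert]
    split_ifs
    · rw [Finset.card_insert_of_notMem (by simp)]
    · rfl

/-- Computes the first `i` sets of the greedy packing, when `cand i w` gives sets that enclose the
basis of round `i`, the loads before this round being `w`. -/
noncomputable def rebuild (d : ℕ) (cand : ℕ → (α → ℕ) → Set α × Set α) :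
    ℕ → QueryProg α (ℕ → Set α)
  | 0 => .done fun _ => ∅
  | i + 1 => (rebuild d cand i).bind fun J =>
      (findGreedy d (multiplicity J i) (cand i (multiplicity J i)).1
        (cand i (multiplicity J i)).2).bind fun X => .done (Function.update J i X)

/-- The sets that `cand` proposes in round `i` enclose the basis of this round. -/
def Encloses (M : Matroid α) (K : ℕ) (cand : ℕ → (α → ℕ) → Set α × Set α) (i : ℕ) : Prop :=
  (cand i (load M K i)).1 ⊆ packing M K i ∧ packing M K i ⊆ (cand i (load M K i)).2 ∧
    (cand i (load M K i)).2 ⊆ {x ∈ M.E | load M K i x < K}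

theorem result_rebuild (M : Matroid α) [M.Finite] {K d : ℕ}
    {cand : ℕ → (α → ℕ) → Set α × Set α} (hd : M.E.ncard ≤ 2 ^ d) {i : ℕ}
    (hcand : ∀ j < i, Encloses M K cand j) :
    ∀ j < i, (rebuild d cand i).result M j = packing M K j := by
  induction i with
  | zero => intro j hj; omega
  | succ i ih =>
    have ih := ih fun j hj => hcand j (by omega)
    obtain ⟨hP, hGQ, hQ⟩ := hcand i (by omega)
    intro j hj
    rw [rebuild, QueryProg.result_bind, QueryProg.result_bind, QueryProg.result,
      multiplicity_congr ih, ← load_eq_multiplicity, result_findGreedy M hP hGQ hQ hd]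
    rcases Nat.lt_succ_iff_lt_or_eq.1 hj with h | rfl
    · rw [Function.update_of_ne h.ne, ih j h]
    · rw [Function.update_self]; rfl

theorem cost_rebuild_le (M : Matroid α) [M.Finite] {K c d : ℕ}
    {cand : ℕ → (α → ℕ) → Set α × Set α} (hd : M.E.ncard ≤ 2 ^ d) {i : ℕ}
    (hcand : ∀ j < i, Encloses M K cand j)
    (hc : ∀ j < i, (packing M K j).ncard ≤ (cand j (load M K j)).1.ncard + c ∨
      (cand j (load M K j)).2.ncard ≤ (packing M K j).ncard + c) :
    (rebuild d cand i).cost M ≤ i * (2 + c * d) := by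
  induction i with
  | zero => exact Nat.zero_le _
  | succ i ih =>
    have ih := ih (fun j hj => hcand j (by omega)) fun j hj => hc j (by omega)
    obtain ⟨hP, hGQ, hQ⟩ := hcand i (by omega)
    rw [rebuild, QueryProg.cost_bind, QueryProg.cost_bind, QueryProg.cost,
      multiplicity_congr (result_rebuild M hd fun j hj => hcand j (by omega)),
      ← load_eq_multiplicity]
    have := cost_findGreedy_le (d := d) M hP hGQ hQ (hc i (by omega))
    rw [Nat.succ_mul]
    omega

end Rebuild

/-! ### The fractional packing number -/

theorem one_le_of_mem_packingRatios (M : Matroid α) [M.Finite] {r : ℝ}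
    (hr : r ∈ packingRatios M) : 1 ≤ r := by
  obtain ⟨A, hA, hlt, rfl⟩ := hr
  have h1 := rk_union_le_add_ncard M (A := M.E \ A) (M.ground_finite.subset hA)
  rw [sdiff_union_of_subset hA] at h1
  have h2 : (rk M M.E : ℝ) ≤ rk M (M.E \ A) + A.ncard := by exact_mod_cast h1
  have h3 : (rk M (M.E \ A) : ℝ) < rk M M.E := by exact_mod_cast hlt
  rw [le_div_iff₀ (by linarith)]
  linarith

theorem packingRatios_nonempty (M : Matroid α) (hM : 0 < rk M M.E) :
    (packingRatios M).Nonempty :=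
  ⟨_, M.E, subset_rfl, by simpa [rk] using hM, rfl⟩

theorem one_le_packingNumber (M : Matroid α) [M.Finite] (hM : 0 < rk M M.E) :
    1 ≤ packingNumber M :=
  le_csInf (packingRatios_nonempty M hM) fun _ hr => one_le_of_mem_packingRatios M hr

theorem packingNumber_mul_le (M : Matroid α) [M.Finite] {A : Set α} (hA : A ⊆ M.E) :
    packingNumber M * ((rk M M.E : ℝ) - rk M (M.E \ A)) ≤ A.ncard := by
  have hle : rk M (M.E \ A) ≤ rk M M.E := rk_mono M sdiff_subset
  rcases hle.lt_or_eq with h | h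
  · have h' : (rk M (M.E \ A) : ℝ) < rk M M.E := by exact_mod_cast h
    rw [← le_div_iff₀ (by linarith)]
    exact csInf_le ⟨1, fun r hr => one_le_of_mem_packingRatios M hr⟩ ⟨A, hA, h, rfl⟩
  · rw [h, sub_self, mul_zero]
    exact Nat.cast_nonneg _

/-- Over a ground set with at most one element, the packing number is `1`. -/
theorem packingNumber_eq_one (M : Matroid α) [M.Finite] (hM : 0 < rk M M.E)
    (h : M.E.ncard ≤ 1) : packingNumber M = 1 := by
  refine le_antisymm ?_ (one_le_packingNumber M hM)
  have h1 := packingNumber_mul_le M (subset_refl M.E)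
  rw [sdiff_self, show rk M ∅ = 0 by simp [rk], Nat.cast_zero, sub_zero] at h1
  have h2 : (1 : ℝ) ≤ rk M M.E := by exact_mod_cast hM
  have h3 : (M.E.ncard : ℝ) ≤ 1 := by exact_mod_cast h
  have := one_le_packingNumber M hM
  nlinarith

/-! ### Approximation by the greedy packing -/

section Approximation

variable [LinearOrder α] [WellFoundedLT α]

theorem isBase_packing (M : Matroid α) [M.Finite] {K i : ℕ} (h : ∀ x, load M K i x < K) :
    M.IsBasis (packing M K i) M.E := by
  have := isBasis_greedy M K (load M K i)
  rwa [sep_eq_self_iff_mem_true.2 fun x _ => h x] at this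

/-- As long as no load has reached the cap, at most `K Φ` rounds have been made: a set `A` meets
every basis in at least `rk E - rk (E \ A)` elements, and has total load at most `K |A|`. -/
theorem round_le_mul_packingNumber (M : Matroid α) [M.Finite] (hM : 0 < rk M M.E) {K i : ℕ}
    (hK : 0 < K) (h : ∀ j < i, ∀ x, load M K j x < K) : (i : ℝ) ≤ K * packingNumber M := by
  rw [← div_le_iff₀' (by exact_mod_cast hK)]
  refine le_csInf (packingRatios_nonempty M hM) ?_
  rintro r ⟨A, hA, hlt, rfl⟩
  have hlt' : (rk M (M.E \ A) : ℝ) < rk M M.E := by exact_mod_cast hlt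
  have hAfin := M.ground_finite.subset hA
  have hcount : ∀ j ≤ i, j * rk M M.E ≤
      ∑ x ∈ hAfin.toFinset, load M K j x + j * rk M (M.E \ A) := by
    intro j
    induction j with
    | zero => simp
    | succ j ih =>
      intro hj
      have h1 := ih (by omega)
      have hB := isBase_packing M (h j hj)
      have h2 := rk_eq_ncard_of_isBasis M hB
      have h3 : (packing M K j \ A).ncard ≤ rk M (M.E \ A) := by
        rw [← rk_eq_ncard_of_isBasis M (hB.indep.subset sdiff_subset).isBasis_self]
        exact rk_mono M (sdiff_subset_sdiff_left hB.subset)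
      have h4 := ncard_inter_add_ncard_sdiff_eq_ncard (packing M K j) A
        (M.ground_finite.subset hB.subset)
      rw [sum_load_succ, hAfin.coe_toFinset, Nat.succ_mul, Nat.succ_mul]
      omega
  have h1 : i * rk M M.E ≤ K * A.ncard + i * rk M (M.E \ A) := by
    refine (hcount i le_rfl).trans (Nat.add_le_add_right ?_ _)
    rw [ncard_eq_toFinset_card A hAfin, mul_comm, ← smul_eq_mul]
    exact Finset.sum_le_card_nsmul _ _ _ fun x _ => load_le_cap M K i x
  have h2 : (i : ℝ) * rk M M.E ≤ K * A.ncard + i * rk M (M.E \ A) := by exact_mod_cast h1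
  rw [div_le_div_iff₀ (by exact_mod_cast hK) (by linarith)]
  linarith

omit [LinearOrder α] [WellFoundedLT α] in
/-- Summation by parts for the exponential weights. -/
theorem sum_one_add_pow_eq (ε : ℝ) (w : α → ℕ) {K : ℕ} (hw : ∀ x, w x ≤ K) (s : Finset α) :
    ∑ x ∈ s, (1 + ε) ^ w x =
      s.card + ∑ t ∈ Finset.range K, ε * (1 + ε) ^ t * (s.filter fun x => t < w x).card := by
  have hpow : ∀ m : ℕ, m ≤ K → (1 + ε) ^ m =
      1 + ∑ t ∈ Finset.range K, ε * (1 + ε) ^ t * if t < m then 1 else 0 := by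
    intro m
    induction m with
    | zero => simp
    | succ m ih =>
      intro hm
      have hsplit : ∀ t ∈ Finset.range K, ε * (1 + ε) ^ t * (if t < m + 1 then 1 else 0) =
          ε * (1 + ε) ^ t * (if t < m then 1 else 0) +
            if t = m then ε * (1 + ε) ^ t else 0 := by
        intro t _
        split_ifs <;> first | omega | simp
      rw [Finset.sum_congr rfl hsplit, Finset.sum_add_distrib, ← add_assoc, ← ih (by omega),
        Finset.sum_ite_eq' , if_pos (Finset.mem_range.2 hm)]
      ring
  rw [Finset.sum_congr rfl fun x _ => hpow (w x) (hw x), Finset.sum_add_distrib,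
    Finset.sum_comm]
  congr 1
  · simp
  · refine Finset.sum_congr rfl fun t _ => ?_
    rw [← Finset.mul_sum, Finset.sum_boole]

/-- A greedy basis has exactly `rk E - rk {w < t}` elements of weight at least `t`. -/
theorem packingNumber_mul_card_filter_le (M : Matroid α) [M.Finite] {K t : ℕ} (ht : t ≤ K)
    {w : α → ℕ} (hw : ∀ x, w x < K) {E B : Finset α} (hE : (E : Set α) = M.E)
    (hB : (B : Set α) = greedy M K w) :
    packingNumber M * (B.filter fun x => t ≤ w x).card ≤ (E.filter fun x => t ≤ w x).card := by
  have hA : ((E.filter fun x => t ≤ w x : Finset α) : Set α) ⊆ M.E := by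
    rw [← hE]; exact_mod_cast Finset.filter_subset _ _
  have h1 := packingNumber_mul_le M hA
  rw [Set.ncard_coe_finset] at h1
  refine le_trans (le_of_eq ?_) h1
  have hdiff : M.E \ ((E.filter fun x => t ≤ w x : Finset α) : Set α) =
      {x ∈ M.E | w x < t} := by
    rw [← hE]; ext x; simp +contextual
  have h2 := rk_eq_ncard_of_isBasis M (isBasis_greedy_inter M ht w)
  have h3 := rk_eq_ncard_of_isBasis M (isBasis_greedy M K w)
  rw [sep_eq_self_iff_mem_true.2 fun x _ => hw x] at h3
  rw [hdiff, h2, h3, ← hB]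
  have h4 : ((B : Set α) ∩ {x | w x < t}) = ((B.filter fun x => w x < t : Finset α) : Set α) := by
    ext x; simp
  rw [h4, Set.ncard_coe_finset, Set.ncard_coe_finset,
    ← Finset.card_filter_add_card_filter_not (s := B) fun x => w x < t]
  simp

/-- The exponential weight of the greedy basis is at most a `1 / Φ` fraction of the total, because
this holds for the number of elements above every weight threshold. -/
theorem packingNumber_mul_sum_greedy_le (M : Matroid α) [M.Finite] {ε : ℝ} (hε : 0 ≤ ε) {K : ℕ}
    {w : α → ℕ} (hw : ∀ x, w x < K) {E B : Finset α} (hE : (E : Set α) = M.E)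
    (hB : (B : Set α) = greedy M K w) :
    packingNumber M * ∑ x ∈ B, (1 + ε) ^ w x ≤ ∑ x ∈ E, (1 + ε) ^ w x := by
  rw [sum_one_add_pow_eq ε w (fun x => (hw x).le) B, sum_one_add_pow_eq ε w (fun x => (hw x).le) E,
    mul_add, Finset.mul_sum]
  refine add_le_add ?_ (Finset.sum_le_sum fun t ht => ?_)
  · simpa using packingNumber_mul_card_filter_le M (Nat.zero_le K) hw hE hB
  · have h := packingNumber_mul_card_filter_le M (t := t + 1) (Finset.mem_range.1 ht) hw hE hB
    simp only [Nat.succ_le_iff] at h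
    rw [mul_left_comm]
    exact mul_le_mul_of_nonneg_left h (by positivity)

/-- The multiplicative-weights bound on the exponential potential. -/
theorem sum_one_add_pow_load_le (M : Matroid α) [M.Finite] (hM : 0 < rk M M.E) {ε : ℝ}
    (hε : 0 ≤ ε) {K i : ℕ} (h : ∀ j < i, ∀ x, load M K j x < K) {E : Finset α}
    (hE : (E : Set α) = M.E) :
    ∑ x ∈ E, (1 + ε) ^ load M K i x ≤ E.card * (1 + ε / packingNumber M) ^ i := by
  classical
  have hΦ := one_le_packingNumber M hM
  induction i with
  | zero => simp [load]
  | succ i ih =>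
    have hi := ih fun j hj => h j (by omega)
    obtain ⟨B, hB⟩ : ∃ B : Finset α, (B : Set α) = packing M K i :=
      ⟨(M.ground_finite.subset (greedy_subset_ground M K (load M K i))).toFinset, by
        rw [Set.Finite.coe_toFinset, packing]⟩
    have hgreedy := packingNumber_mul_sum_greedy_le M hε (h i (by omega)) hE hB
    have hBE : B ⊆ E := by
      rw [← Finset.coe_subset, hB, hE]; exact greedy_subset_ground _ _ _
    have hstep : ∑ x ∈ E, (1 + ε) ^ load M K (i + 1) x =
        ∑ x ∈ E, (1 + ε) ^ load M K i x + ε * ∑ x ∈ B, (1 + ε) ^ load M K i x := by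
      rw [← Finset.inter_eq_right.2 hBE, ← Finset.filter_mem_eq_inter, Finset.sum_filter,
        Finset.mul_sum, ← Finset.sum_add_distrib]
      refine Finset.sum_congr rfl fun x _ => ?_
      rw [load_succ, ← hB]
      simp only [Finset.mem_coe]
      split_ifs
      · ring
      · simp
    rw [hstep, pow_succ, ← mul_assoc]
    have hdiv : ∑ x ∈ B, (1 + ε) ^ load M K i x ≤
        (∑ x ∈ E, (1 + ε) ^ load M K i x) / packingNumber M := by
      rw [le_div_iff₀' (by linarith)]; exact hgreedy
    calc ∑ x ∈ E, (1 + ε) ^ load M K i x + ε * ∑ x ∈ B, (1 + ε) ^ load M K i x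
        ≤ ∑ x ∈ E, (1 + ε) ^ load M K i x +
            ε * ((∑ x ∈ E, (1 + ε) ^ load M K i x) / packingNumber M) := by gcongr
      _ = (∑ x ∈ E, (1 + ε) ^ load M K i x) * (1 + ε / packingNumber M) := by ring
      _ ≤ _ := by gcongr

/-- When the first load reaches the cap, at least `(1 - ε) K Φ` rounds have been made. -/
theorem mul_packingNumber_le_round (M : Matroid α) [M.Finite] (hM : 0 < rk M M.E) {ε : ℝ}
    (hε : 0 < ε) {K i n : ℕ} (hK : 0 < K) (hKε : 2 * Real.log n ≤ K * ε ^ 2)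
    (hn : M.E.ncard ≤ n) (h : ∀ j < i, ∀ x, load M K j x < K) {x : α}
    (hx : K ≤ load M K i x) : (1 - ε) * (K * packingNumber M) ≤ i := by
  have hΦ := one_le_packingNumber M hM
  have hxE : x ∈ M.E := by
    by_contra hxE
    rw [load_eq_zero_of_notMem M K i hxE] at hx
    omega
  have hE := M.ground_finite.coe_toFinset
  have hcard : (M.ground_finite.toFinset.card : ℝ) ≤ n := by
    rw [← ncard_eq_toFinset_card _ M.ground_finite]; exact_mod_cast hn
  have hn0 : (0 : ℝ) < n := by
    have : 0 < M.E.ncard := (ncard_pos M.ground_finite).2 ⟨x, hxE⟩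
    exact_mod_cast this.trans_le hn
  have h1 : (1 + ε) ^ K ≤ n * (1 + ε / packingNumber M) ^ i := by
    calc (1 + ε) ^ K ≤ (1 + ε) ^ load M K i x := pow_le_pow_right₀ (by linarith) hx
      _ ≤ ∑ y ∈ M.ground_finite.toFinset, (1 + ε) ^ load M K i y :=
          Finset.single_le_sum (f := fun y => (1 + ε) ^ load M K i y)
            (fun y _ => by positivity) (by simpa using hxE)
      _ ≤ _ := sum_one_add_pow_load_le M hM hε.le h hE
      _ ≤ _ := by gcongr
  have hpos : 0 < 1 + ε / packingNumber M := by positivity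
  have h2 := Real.log_le_log (by positivity) h1
  rw [Real.log_pow, Real.log_mul hn0.ne' (by positivity), Real.log_pow] at h2
  have h3 : Real.log (1 + ε / packingNumber M) ≤ ε / packingNumber M := by
    have := Real.log_le_sub_one_of_pos hpos
    linarith
  have h4 : ε * (1 - ε / 2) ≤ Real.log (1 + ε) := by
    refine le_trans ?_ (Real.le_log_one_add_of_nonneg hε.le)
    rw [le_div_iff₀ (by linarith)]
    nlinarith [pow_pos hε 3]
  have hK' : (0 : ℝ) < K := by exact_mod_cast hK
  have h5 : (K : ℝ) * (ε * (1 - ε / 2)) ≤ Real.log n + i * (ε / packingNumber M) :=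
    (mul_le_mul_of_nonneg_left h4 hK'.le).trans
      (h2.trans (by gcongr))
  have h6 : ε * ((1 - ε) * K) ≤ ε * (i / packingNumber M) := by
    calc ε * ((1 - ε) * K) = K * (ε * (1 - ε / 2)) - K * ε ^ 2 / 2 := by ring
      _ ≤ i * (ε / packingNumber M) := by linarith
      _ = _ := by ring
  have h7 := le_of_mul_le_mul_left h6 hε
  rw [le_div_iff₀ (by linarith)] at h7
  linarith

/-- The first round `τ` after which some load has reached the cap `K` gives the approximation
`τ / K` of the packing number. -/
theorem exists_isLeast_round (M : Matroid α) [M.Finite] (hM : 0 < rk M M.E) {ε Φmax : ℝ}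
    (hε : 0 < ε) {K N n : ℕ} (hK : 0 < K) (hKε : 2 * Real.log n ≤ K * ε ^ 2)
    (hn : M.E.ncard ≤ n) (hΦ : packingNumber M ≤ Φmax) (hN : K * Φmax < N) :
    ∃ τ ≤ N, IsLeast {i | ∃ x, K ≤ load M K i x} τ ∧
      (1 - ε) * packingNumber M ≤ (τ : ℝ) / K ∧ (τ : ℝ) / K ≤ packingNumber M := by
  classical
  have hK' : (0 : ℝ) < K := by exact_mod_cast hK
  have hex : ∃ i, i ≤ N ∧ ∃ x, K ≤ load M K i x := by
    by_contra! hcon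
    have h1 := round_le_mul_packingNumber M hM hK (i := N) fun j hj => hcon j hj.le
    have h2 : K * packingNumber M ≤ K * Φmax := by gcongr
    linarith
  obtain ⟨hle, x, hx⟩ := Nat.find_spec hex
  have hmin : ∀ j < Nat.find hex, ∀ x, load M K j x < K := by
    intro j hj y
    by_contra! hy
    exact Nat.find_min hex hj ⟨by omega, y, hy⟩
  refine ⟨Nat.find hex, hle, ⟨⟨x, hx⟩, ?_⟩, ?_, ?_⟩
  · rintro j ⟨y, hy⟩
    by_contra! hj
    exact absurd (hmin j hj y) (by omega)
  · rw [le_div_iff₀ hK']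
    have := mul_packingNumber_le_round M hM hε hK hKε hn hmin hx
    linarith
  · rw [div_le_iff₀' hK']
    exact round_le_mul_packingNumber M hM hK hmin

end Approximation

/-! ### The dynamic algorithm -/

theorem eq_delete_of_isUpdate_insert {M M' : Matroid α} {e : α}
    (h : IsUpdate M (.insert e) M') : M = M'.delete {e} := by
  obtain ⟨he, hE, hI⟩ := h
  refine Matroid.ext_indep ?_ fun I hIE => ?_
  · rw [Matroid.delete_ground, hE, insert_sdiff_self_of_notMem he]
  · have heI : e ∉ I := fun h => he (hIE h)
    rw [Matroid.deleteElem_indep_iff, hI I heI]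
    tauto

theorem eq_delete_of_isUpdate_delete {M M' : Matroid α} {e : α}
    (h : IsUpdate M (.delete e) M') : M' = M.delete {e} := by
  obtain ⟨-, hE, hI⟩ := h
  refine Matroid.ext_indep hE fun I _ => ?_
  rw [Matroid.deleteElem_indep_iff, hI I]

/-- The ground set after an update. -/
def groundAfter : Update α → Set α → Set α
  | .insert e, E => insert e E
  | .delete e, E => E \ {e}

theorem IsUpdate.ground_eq {M M' : Matroid α} {a : Update α} (h : IsUpdate M a M') :
    M'.E = groundAfter a M.E := by
  cases a
  · exact h.2.1
  · exact h.2.1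

/-- Sets that enclose the basis of round `i` after an update, computed from the packing `I` before
the update and the loads `w` before round `i` after the update. After an insertion, only elements
whose load has decreased, and the inserted element, can be new in the basis. After a deletion, only
elements whose load has increased, and the deleted element, can have left it. -/
def candidates (K : ℕ) : Update α → Set α → (ℕ → Set α) → ℕ → (α → ℕ) → Set α × Set α
  | .insert e, E, I, i, w =>
    (∅, {x | (x ∈ I i ∨ x ∈ insert e {y ∈ E | w y < multiplicity I i y}) ∧ w x < K})
  | .delete e, E, I, i, w =>
    (I i \ insert e {y ∈ E \ {e} | multiplicity I i y < w y}, {x ∈ E \ {e} | w x < K})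

/-- The upper candidate set after an insertion exceeds the new basis by at most `K + 1` elements,
since a basis of the packing does not shrink. -/
theorem candidates_insert_spec [LinearOrder α] [WellFoundedLT α] {M M' : Matroid α} {e : α}
    [M'.Finite] (h : IsUpdate M (.insert e) M') {K i : ℕ} {I : ℕ → Set α}
    (hI : ∀ j ≤ i, I j = packing M K j) :
    Encloses M' K (candidates K (.insert e) M.E I) i ∧
      (candidates K (.insert e) M.E I i (load M' K i)).2.ncard ≤
        (packing M' K i).ncard + (K + 1) := by
  have he : e ∈ M'.E := by rw [h.ground_eq]; exact mem_insert _ _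
  have hM := eq_delete_of_isUpdate_insert h
  have hmult : multiplicity I i = load M K i := by
    rw [load_eq_multiplicity, multiplicity_congr fun j hj => hI j hj.le]
  have hcard := ncard_load_lt_load_delete_le M' e K i
  have hpack := ncard_packing_delete_le M' e K i
  have hmono := load_le_load_delete M' e K i
  rw [← hM] at hcard hpack hmono
  have hIE : packing M K i ⊆ M.E := greedy_subset_ground _ _ _
  have hEE : M.E ⊆ M'.E := by rw [h.ground_eq]; exact subset_insert _ _
  refine ⟨⟨empty_subset _, ?_, ?_⟩, ?_⟩
  · intro x hx
    refine ⟨?_, hx.2.1⟩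
    rw [hmult, hI i le_rfl]
    by_cases hxe : x = e
    · exact Or.inr (Or.inl hxe)
    have hxE : x ∈ M.E := by rw [hM]; exact ⟨hx.1, hxe⟩
    rcases (hmono x hxE).lt_or_eq with hlt | heq
    · exact Or.inr (Or.inr ⟨hxE, hlt⟩)
    · refine Or.inl ?_
      subst hM
      exact mem_greedy_delete M' hmono hxE heq hx
  · rintro x ⟨hx | rfl | hx, hw⟩
    · rw [hI i le_rfl] at hx
      exact ⟨hEE (hIE hx), hw⟩
    · exact ⟨he, hw⟩
    · exact ⟨hEE hx.1, hw⟩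
  · simp only [candidates]
    rw [hmult, hI i le_rfl]
    have hfin : (packing M K i ∪ insert e {y ∈ M.E | load M' K i y < load M K i y}).Finite :=
      M'.ground_finite.subset (union_subset (hIE.trans hEE)
        (insert_subset he fun x hx => hEE hx.1))
    refine (ncard_le_ncard (fun x hx => hx.1) hfin).trans ?_
    have h1 := ncard_union_le (packing M K i)
      (insert e {y ∈ M.E | load M' K i y < load M K i y})
    have h2 := ncard_insert_le e {y ∈ M.E | load M' K i y < load M K i y}
    omega

/-- After a deletion, at most `K + 1` elements have to be added to the lower candidate set, since a
basis of the packing does not grow. -/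
theorem candidates_delete_spec [LinearOrder α] [WellFoundedLT α] {M M' : Matroid α} {e : α}
    [M.Finite] (h : IsUpdate M (.delete e) M') {K i : ℕ} {I : ℕ → Set α}
    (hI : ∀ j ≤ i, I j = packing M K j) :
    Encloses M' K (candidates K (.delete e) M.E I) i ∧
      (packing M' K i).ncard ≤
        (candidates K (.delete e) M.E I i (load M' K i)).1.ncard + (K + 1) := by
  obtain rfl := eq_delete_of_isUpdate_delete h
  have hmult : multiplicity I i = load M K i := by
    rw [load_eq_multiplicity, multiplicity_congr fun j hj => hI j hj.le]
  have hcard := ncard_load_lt_load_delete_le M e K i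
  have hpack := ncard_packing_delete_le M e K i
  have hmono := load_le_load_delete M e K i
  refine ⟨⟨?_, fun x hx => ⟨hx.1, hx.2.1⟩, fun x hx => hx⟩, ?_⟩
  · rintro x ⟨hx, hxD⟩
    rw [hI i le_rfl] at hx
    rw [hmult] at hxD
    have hxE : x ∈ (M.delete {e}).E := ⟨hx.1, fun hxe => hxD (Or.inl hxe)⟩
    refine mem_greedy_delete M hmono hxE ((hmono x hxE).eq_of_not_lt fun hlt => ?_) hx
    exact hxD (Or.inr ⟨hxE, hlt⟩)
  · simp only [candidates]
    rw [hmult, hI i le_rfl]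
    have hfin : (insert e {y ∈ M.E \ {e} | load M K i y < load (M.delete {e}) K i y}).Finite :=
      (M.ground_finite.subset fun x hx => hx.1.1).insert e
    have h1 := ncard_le_ncard_sdiff_add_ncard (packing M K i)
      (insert e {y ∈ M.E \ {e} | load M K i y < load (M.delete {e}) K i y}) hfin
    have h2 := ncard_insert_le e {y ∈ M.E \ {e} | load M K i y < load (M.delete {e}) K i y}
    rw [Matroid.delete_ground] at hcard
    omega

section Algorithm

variable [LinearOrder α] [WellFoundedLT α]

theorem candidates_spec {M M' : Matroid α} {a : Update α} [M.Finite] [M'.Finite]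
    (h : IsUpdate M a M') {K i : ℕ} {I : ℕ → Set α} (hI : ∀ j ≤ i, I j = packing M K j) :
    Encloses M' K (candidates K a M.E I) i ∧
      ((packing M' K i).ncard ≤ (candidates K a M.E I i (load M' K i)).1.ncard + (K + 1) ∨
        (candidates K a M.E I i (load M' K i)).2.ncard ≤ (packing M' K i).ncard + (K + 1)) := by
  cases a with
  | insert e => exact (candidates_insert_spec h hI).imp_right Or.inr
  | delete e => exact (candidates_delete_spec h hI).imp_right Or.inl

omit [WellFoundedLT α] in
theorem encloses_ground (M : Matroid α) (K i : ℕ) :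
    Encloses M K (fun _ w => (∅, {x ∈ M.E | w x < K})) i :=
  ⟨empty_subset _, fun _ hx => ⟨hx.1, hx.2.1⟩, subset_rfl⟩

variable (α) in
/-- The dynamic algorithm that maintains the ground set and the first `N` bases of the greedy
packing with cap `K`. With `τ` the first round after which some load has reached `K`, its value is
`τ / K`. The bisections have depth at most `d`. -/
noncomputable def greedyAlgorithm (K N d : ℕ) : DynAlgorithm α where
  State := Set α × (ℕ → Set α)
  init E := (rebuild d (fun _ w => (∅, {x ∈ E | w x < K})) N).bind fun J => .done (E, J)
  update a s := (rebuild d (candidates K a s.1 s.2) N).bind fun J => .done (groundAfter a s.1, J)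
  output s := (sInf {i | ∃ x, K ≤ multiplicity s.2 i x} : ℕ) / K

omit [LinearOrder α] [WellFoundedLT α] in
theorem finite_of_encard_le {M : Matroid α} {n : ℕ} (h : M.E.encard ≤ n) : M.Finite :=
  ⟨finite_of_encard_le_coe h⟩

omit [LinearOrder α] [WellFoundedLT α] in
theorem ncard_le_of_encard_le {M : Matroid α} {n : ℕ} (h : M.E.encard ≤ n) : M.E.ncard ≤ n := by
  rw [← (finite_of_encard_le_coe h).cast_ncard_eq] at h
  exact_mod_cast h

/-- The state agrees with the greedy packing of the current matroid. -/
theorem greedyAlgorithm_state {K N d n : ℕ} (hd : n ≤ 2 ^ d) {Φmax : ℝ} {M : ℕ → Matroid α}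
    {u : ℕ → Update α} {T : ℕ} (hM : IsDynamicMatroid M u T) (hb : IsBounded n Φmax M T) :
    ∀ t ≤ T, ((greedyAlgorithm α K N d).state M u t).1 = (M t).E ∧
      ∀ j < N, ((greedyAlgorithm α K N d).state M u t).2 j = packing (M t) K j := by
  intro t
  induction t with
  | zero =>
    intro ht
    have := finite_of_encard_le (hb 0 ht).1
    rw [DynAlgorithm.state]
    simp only [greedyAlgorithm, QueryProg.result_bind, QueryProg.result]
    exact ⟨trivial, result_rebuild _ ((ncard_le_of_encard_le (hb 0 ht).1).trans hd)
      fun j _ => encloses_ground _ K j⟩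
  | succ t ih =>
    intro ht
    obtain ⟨h1, h2⟩ := ih (by omega)
    have := finite_of_encard_le (hb t (by omega)).1
    have := finite_of_encard_le (hb (t + 1) ht).1
    rw [DynAlgorithm.state]
    generalize (greedyAlgorithm α K N d).state M u t = s at h1 h2
    simp only [greedyAlgorithm, QueryProg.result_bind, QueryProg.result]
    rw [h1]
    refine ⟨(hM t ht).ground_eq.symm,
      result_rebuild _ ((ncard_le_of_encard_le (hb _ ht).1).trans hd) fun j hj => ?_⟩
    exact (candidates_spec (hM t ht) fun k hk => h2 k (by omega)).1

theorem greedyAlgorithm_queries_le {K N d n : ℕ} (hd : n ≤ 2 ^ d) {Φmax : ℝ} {M : ℕ → Matroid α}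
    {u : ℕ → Update α} {T : ℕ} (hM : IsDynamicMatroid M u T) (hb : IsBounded n Φmax M T)
    {t : ℕ} (ht : t < T) :
    (greedyAlgorithm α K N d).queries M u t ≤ N * (2 + (K + 1) * d) := by
  obtain ⟨h1, h2⟩ := greedyAlgorithm_state (K := K) (N := N) hd hM hb t ht.le
  have := finite_of_encard_le (hb t ht.le).1
  have := finite_of_encard_le (hb (t + 1) ht).1
  rw [DynAlgorithm.queries]
  generalize (greedyAlgorithm α K N d).state M u t = s at h1 h2
  simp only [greedyAlgorithm, QueryProg.cost_bind, QueryProg.cost]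
  rw [h1, add_zero]
  have hspec := fun j (hj : j < N) => candidates_spec (K := K) (i := j) (hM t ht)
    fun k hk => h2 k (by omega)
  exact cost_rebuild_le _ ((ncard_le_of_encard_le (hb _ ht).1).trans hd)
    (fun j hj => (hspec j hj).1) fun j hj => (hspec j hj).2

theorem greedyAlgorithm_maintains {K N d n : ℕ} (hd : n ≤ 2 ^ d) {ε Φmax : ℝ} (hε : 0 < ε)
    (hK : 0 < K) (hKε : 2 * Real.log n ≤ K * ε ^ 2) (hN : K * Φmax < N) :
    (greedyAlgorithm α K N d).Maintains ε n Φmax := by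
  intro M u T hM hb t ht hrk
  obtain ⟨-, h2⟩ := greedyAlgorithm_state (K := K) (N := N) hd hM hb t ht
  have := finite_of_encard_le (hb t ht).1
  obtain ⟨τ, hτN, hτ, hlow, hup⟩ := exists_isLeast_round (M t) hrk hε hK hKε
    (ncard_le_of_encard_le (hb t ht).1) ((hb t ht).2 hrk) hN
  rw [DynAlgorithm.value]
  generalize (greedyAlgorithm α K N d).state M u t = s at h2
  have hmult : ∀ i ≤ N, load (M t) K i = multiplicity s.2 i := fun i hi => by
    rw [load_eq_multiplicity, multiplicity_congr fun j hj => h2 j (by omega)]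
  have hleast : IsLeast {i | ∃ x, K ≤ multiplicity s.2 i x} τ := by
    refine ⟨?_, fun i hi => ?_⟩
    · obtain ⟨x, hx⟩ := hτ.1
      exact ⟨x, by rwa [← hmult τ hτN]⟩
    · by_contra! hlt
      refine absurd (hτ.2 ?_) (not_le.2 hlt)
      obtain ⟨x, hx⟩ := hi
      exact ⟨x, by rwa [hmult i (by omega)]⟩
  have hout : (greedyAlgorithm α K N d).output s = (τ : ℝ) / K := by
    simp only [greedyAlgorithm]
    rw [hleast.csInf_eq]
  rw [hout]
  have := one_le_packingNumber (M t) hrk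
  exact ⟨hlow, by nlinarith⟩

end Algorithm

/-! ### Choice of the parameters -/

variable (α) in
/-- The algorithm that asks no queries and always outputs `1`. -/
noncomputable def constantAlgorithm : DynAlgorithm α where
  State := PUnit
  init _ := .done ⟨⟩
  update _ _ := .done ⟨⟩
  output _ := 1

/-- If `n = 1` or `Φmax < 1`, the packing number is `1` whenever the bounds hold: `1 ≤ Φ`
always, so the second case does not occur in positive rank. -/
theorem constantAlgorithm_maintains {ε Φmax : ℝ} (hε : 0 < ε) {n : ℕ}
    (h : n = 1 ∨ Φmax < 1) : (constantAlgorithm α).Maintains ε n Φmax := by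
  intro M u T hM hb t ht hrk
  have := finite_of_encard_le (hb t ht).1
  have hΦ : packingNumber (M t) = 1 := by
    rcases h with rfl | h
    · exact packingNumber_eq_one _ hrk (ncard_le_of_encard_le (hb t ht).1)
    · linarith [one_le_packingNumber _ hrk, (hb t ht).2 hrk]
  rw [hΦ]
  constructor <;> simp only [DynAlgorithm.value, constantAlgorithm] <;> linarith

theorem constantAlgorithm_queries (M : ℕ → Matroid α) (u : ℕ → Update α) (t : ℕ) :
    (constantAlgorithm α).queries M u t = 0 := rfl

theorem DynAlgorithm.WorstCaseQueries.mono {𝒜 : DynAlgorithm α} {n : ℕ} {Φmax q q' : ℝ}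
    (h : 𝒜.WorstCaseQueries n Φmax q) (hq : q ≤ q') : 𝒜.WorstCaseQueries n Φmax q' :=
  fun M u T hM hb t ht => (h M u T hM hb t ht).trans hq

theorem DynAlgorithm.WorstCaseQueries.amortized {𝒜 : DynAlgorithm α} {n : ℕ} {Φmax q : ℝ}
    (h : 𝒜.WorstCaseQueries n Φmax q) : 𝒜.AmortizedQueries n Φmax q := by
  intro M u T hM hb
  refine (Finset.sum_le_card_nsmul _ _ q fun t ht =>
    h M u T hM hb t (Finset.mem_range.1 ht)).trans_eq ?_
  rw [Finset.card_range, nsmul_eq_mul, mul_comm]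

/-- With cap `K = ⌈2 log n / ε²⌉` there are at most `2 K Φmax` rounds, and each of them takes
`O(K log n)` queries. -/
theorem parameters_bound {ε Φmax : ℝ} (hε : 0 < ε) (hε' : ε < 1 / 2) (hΦ : 1 ≤ Φmax) {n : ℕ}
    (hn : 2 ≤ n) {K : ℕ} (hK : K = ⌈2 * Real.log n / ε ^ 2⌉₊) :
    ((⌊K * Φmax⌋₊ + 1 : ℕ) : ℝ) * (2 + (K + 1) * (Nat.clog 2 n : ℕ)) ≤
      384 * (Φmax * (ε ^ 4)⁻¹ * Real.log n ^ 3) := by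
  have hn' : (2 : ℝ) ≤ n := by exact_mod_cast hn
  have hlog2 := Real.log_two_gt_d9
  have hlog : Real.log 2 ≤ Real.log n := Real.log_le_log (by norm_num) hn'
  set L := Real.log n
  have hε2 : 0 < ε ^ 2 := by positivity
  have hX : 4 ≤ 2 * L / ε ^ 2 := by
    rw [le_div_iff₀ hε2]
    nlinarith
  have hK1 : 1 ≤ (K : ℝ) := by
    rw [hK]; exact le_trans (by linarith) (Nat.le_ceil _)
  have hK2 : (K : ℝ) ≤ 4 * L / ε ^ 2 := by
    have h1 := Nat.ceil_lt_add_one (show 0 ≤ 2 * L / ε ^ 2 by linarith)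
    rw [← hK] at h1
    have h2 : 4 * L / ε ^ 2 = 2 * (2 * L / ε ^ 2) := by ring
    linarith
  have hN : ((⌊K * Φmax⌋₊ + 1 : ℕ) : ℝ) ≤ 2 * K * Φmax := by
    push_cast
    have := Nat.floor_le (show 0 ≤ K * Φmax by positivity)
    nlinarith
  have hd1 : 1 ≤ (Nat.clog 2 n : ℝ) := by
    exact_mod_cast Nat.clog_pos (by norm_num) hn
  have hd : (Nat.clog 2 n : ℝ) ≤ 3 * L := by
    have h1 : 2 ^ (Nat.clog 2 n - 1) < n := by
      exact Nat.pow_pred_clog_lt_self (by norm_num) hn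
    have h2 : ((2 : ℝ) ^ (Nat.clog 2 n - 1)) ≤ n := by exact_mod_cast h1.le
    have h3 := Real.log_le_log (by positivity) h2
    rw [Real.log_pow, Nat.cast_sub (by exact_mod_cast hd1), Nat.cast_one] at h3
    nlinarith
  have hstage : 2 + ((K : ℝ) + 1) * (Nat.clog 2 n : ℕ) ≤ 12 * K * L := by
    nlinarith
  calc ((⌊K * Φmax⌋₊ + 1 : ℕ) : ℝ) * (2 + (K + 1) * (Nat.clog 2 n : ℕ))
      ≤ (2 * K * Φmax) * (12 * K * L) := by gcongr
    _ = 24 * (K * K) * (Φmax * L) := by ring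
    _ ≤ 24 * ((4 * L / ε ^ 2) * (4 * L / ε ^ 2)) * (Φmax * L) := by gcongr
    _ = 384 * (Φmax * (ε ^ 4)⁻¹ * L ^ 3) := by field_simp; ring

/-- A single algorithm whose worst-case bound is linear in `Φmax`. -/
theorem exists_algorithm_worstCaseQueries (α : Type u) {ε : ℝ} {n : ℕ} {Φmax : ℝ} (hε : 0 < ε)
    (hε' : ε < 1 / 2) (hn : 1 ≤ n) (hΦ : 0 < Φmax) :
    ∃ 𝒜 : DynAlgorithm α, 𝒜.Maintains ε n Φmax ∧
      𝒜.WorstCaseQueries n Φmax (384 * (Φmax * (ε ^ 4)⁻¹ * Real.log n ^ 3)) ∧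
      𝒜.WorstCaseQueries n Φmax (384 * (Φmax ^ 2 * (ε ^ 4)⁻¹ * Real.log n ^ 3)) := by
  have hlog : 0 ≤ Real.log n := Real.log_natCast_nonneg n
  by_cases h : n = 1 ∨ Φmax < 1
  -- For `n = 1` the bound is `0`, and for `Φmax < 1` there may be no room for even one query.
  · refine ⟨constantAlgorithm α, constantAlgorithm_maintains hε h, ?_, ?_⟩ <;>
    · intro M u T _ _ t _
      rw [constantAlgorithm_queries, Nat.cast_zero]
      positivity
  · push Not at h
    obtain ⟨hn1, hΦ1⟩ := h
    have hn2 : 2 ≤ n := by omega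
    obtain ⟨_, _⟩ := exists_wellFoundedLT (α := α)
    obtain ⟨K, hK⟩ : ∃ K, K = ⌈2 * Real.log n / ε ^ 2⌉₊ := ⟨_, rfl⟩
    have hKle : 2 * Real.log n / ε ^ 2 ≤ K := by rw [hK]; exact Nat.le_ceil _
    have hKpos : 0 < K := by
      rw [hK, Nat.ceil_pos]
      have : 0 < Real.log n := Real.log_pos (by exact_mod_cast hn2)
      positivity
    have hd : n ≤ 2 ^ Nat.clog 2 n := Nat.le_pow_clog (by norm_num) n
    have hlin : (greedyAlgorithm α K (⌊K * Φmax⌋₊ + 1) (Nat.clog 2 n)).WorstCaseQueries n Φmax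
        (384 * (Φmax * (ε ^ 4)⁻¹ * Real.log n ^ 3)) := by
      intro M u T hM hb t ht
      refine le_trans ?_ (parameters_bound hε hε' hΦ1 hn2 hK)
      exact_mod_cast greedyAlgorithm_queries_le (K := K) (N := ⌊K * Φmax⌋₊ + 1) hd hM hb ht
    refine ⟨_, greedyAlgorithm_maintains hd hε hKpos ?_ ?_, hlin, hlin.mono ?_⟩
    · rwa [div_le_iff₀ (by positivity)] at hKle
    · exact_mod_cast Nat.lt_floor_add_one (K * Φmax)
    · gcongr
      nlinarith

end DynMatroid

theorem mainTheorem1 :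
    ∃ C : ℝ, 0 < C ∧
      ∀ (α : Type u) (ε : ℝ) (n : ℕ) (Φmax : ℝ),
        0 < ε → ε < 1 / 2 → 1 ≤ n → 0 < Φmax →
          (∃ 𝒜 : DynMatroid.DynAlgorithm α, 𝒜.Maintains ε n Φmax ∧
            𝒜.WorstCaseQueries n Φmax (C * (Φmax ^ 2 * (ε ^ 4)⁻¹ * Real.log n ^ 3))) ∧
          (∃ 𝒜 : DynMatroid.DynAlgorithm α, 𝒜.Maintains ε n Φmax ∧
            𝒜.AmortizedQueries n Φmax (C * (Φmax * (ε ^ 4)⁻¹ * Real.log n ^ 3))) := by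
  refine ⟨384, by norm_num, fun α ε n Φmax hε hε' hn hΦ => ?_⟩
  obtain ⟨𝒜, hmaint, hlin, hquad⟩ :=
    DynMatroid.exists_algorithm_worstCaseQueries α hε hε' hn hΦ
  exact ⟨⟨𝒜, hmaint, hquad⟩, ⟨𝒜, hmaint, hlin.amortized⟩⟩
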